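/- **Model.** There are $n$ candidates, each with a pair of non-negative valuations $(\rho,\xi)$, where $\rho$ is the receiver's and $\xi$ the sender's value if the candidate is hired. An instance is a multiset of $n$ such pairs. The candidates arrive in uniformly random order over rounds $1,\dots,n$. A (direct, possibly randomized) mechanism $\phi$ sends in each round $t$ a signal in $\{\mathrm{HIRE},\mathrm{NOT}\}$, based on the valuation pairs that have arrived in rounds $1,\dots,t$ and on its own earlier signals. After each signal the receiver decides irrevocably whether to hire the current candidate; the process ends with the first hire, and both players get $0$ if nobody is hired. The receiver knows $\phi$ and the instance, and observes the signals; *with disclosure* she also observes the pairs of the rejected candidates of all earlier rounds. She has cardinal utility, i.e. maximizes the expected value of $\rho$ of the hired candidate. The mechanism is *persuasive for an instance* if in every round, given everything she has observed after obeying all earlier signals, obeying all signals from then on (hire exactly upon HIRE) maximizes her conditional expected utility among all her continuation strategies (ties allowed). In the *secretary scenario* the sender does not know the instance, so a mechanism is called *persuasive* there if it is persuasive for every instance with $n$ candidates. The sender's *success probability* is the probability that, under obedience, the hired candidate has the largest $\xi$-value of the instance; her *expected utility* is the expected $\xi$-value of the hired candidate. In the *benchmark* (basic scenario without disclosure) the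 sender knows the instance; $\mathrm{OPT}$ of an instance is the supremum, over all mechanisms persuasive for that instance without disclosure, of the success probability (ordinal sender), respectively of the expected utility (cardinal sender). **Theorem.** (1) For every $n\ge 1$ there is an instance with $n$ candidates and $\mathrm{OPT}>0$ (in both senses) on which every mechanism that is persuasive in the secretary scenario with disclosure has success probability at most $\frac2n\cdot\mathrm{OPT}$ (ordinal $\mathrm{OPT}$) and expected sender utility at most $\frac2n\cdot\mathrm{OPT}$ (cardinal $\mathrm{OPT}$). In particular, no persuasive mechanism guarantees the sender more than $\frac2n\cdot\mathrm{OPT}$, in either sense. (2) More precisely, for $n\ge2$ let instance I consist of $a=(\rho,\xi)=(0,1)$, $b=(1,0)$ and $n-2$ copies of $c=(\tfrac12,0)$, and let instance II consist of $a=(0,1)$ and $n-1$ copies of $c=(\tfrac12,0)$. For instance I, $\mathrm{OPT}=\tfrac12$ in both senses, and it is attained; the mechanism that always signals HIRE (so that the receiver hires in round 1) has success probability and expected utility exactly $\frac1n$ on instance I. Every mechanism that is persuasive with disclosure for both instances I and II has, on instance I, success probability at most $\frac2n\cdot\mathrm{OPT}$ and expected utility at most $\frac2n\cdot\mathrm{OPT}$,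 and thus neither value exceeds that of hiring in round 1. -/

import Mathlib

open scoped NNReal

namespace OnlinePersuasion

noncomputable section

/-- A candidate is what the sender observes on arrival: the pair `(ρ, ξ)` of non-negative
valuations, the first for the receiver and the second for the sender. -/
abbrev Candidate := ℝ≥0 × ℝ≥0

/-- The receiver's value of a candidate. -/
def rho (c : Candidate) : ℝ := c.1

/-- The sender's value of a candidate. -/
def xi (c : Candidate) : ℝ := c.2

/-- An instance with `n` candidates: a family (multiset) of `n` valuation pairs. -/
abbrev Instance (n : ℕ) := Fin n → Candidate

/-- A (randomized) direct signaling strategy for `n` rounds. In round `t` the sender has seen the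
candidates of rounds `≤ t` and remembers her own signals of rounds `< t`; `hireProb` is the
conditional probability that the signal of round `t` is HIRE. -/
structure Mechanism (n : ℕ) where
  hireProb : (t : Fin n) → (Set.Iic t → Candidate) → (Set.Iio t → Bool) → unitInterval

/-- The probability that `φ` emits the signals `s` (`true` is HIRE, `false` is NOT) when the
candidates arrive in the sequence `x`. -/
def signalProb {n : ℕ} (φ : Mechanism n) (x : Fin n → Candidate) (s : Fin n → Bool) : ℝ :=
  ∏ t : Fin n,
    if s t = true then (φ.hireProb t (fun i => x i) (fun i => s i) : ℝ)
    else 1 - (φ.hireProb t (fun i => x i) (fun i => s i) : ℝ)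

/-- Expectation of `f (arrival sequence) (signals)` when the candidates of `θ` arrive in uniformly
random order and the sender uses `φ`. -/
def expect {n : ℕ} (φ : Mechanism n) (θ : Instance n)
    (f : (Fin n → Candidate) → (Fin n → Bool) → ℝ) : ℝ :=
  (∑ π : Equiv.Perm (Fin n), ∑ s : Fin n → Bool,
      signalProb φ (θ ∘ π) s * f (θ ∘ π) s) / (Nat.factorial n : ℝ)

open Classical in
/-- The payoff `u (x r)` where `r` is the first round `≥ start` in which the decision `d` is to
hire, and `0` if there is no such round. -/
def payoff {n : ℕ} (u : Candidate → ℝ) (start : ℕ) (d : Fin n → Bool) (x : Fin n → Candidate) :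
    ℝ :=
  ∑ r : Fin n,
    if start ≤ (r : ℕ) ∧ d r = true ∧ ∀ q : Fin n, start ≤ (q : ℕ) → q < r → d q = false
    then u (x r) else 0

/-- A receiver strategy with disclosure: the decision in round `t` (`true` means hire) depends on
the rejected candidates of rounds `< t` and on the signals of rounds `≤ t`. -/
abbrev DisclosureStrategy (n : ℕ) :=
  (t : Fin n) → (Set.Iio t → Candidate) → (Set.Iic t → Bool) → Bool

/-- A receiver strategy without disclosure: the decision in round `t` depends only on the signals
of rounds `≤ t`. -/
abbrev NoDisclosureStrategy (n : ℕ) :=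
  (t : Fin n) → (Set.Iic t → Bool) → Bool

open Classical in
/-- `φ` is persuasive for the instance `θ` (known to the receiver) in the scenario with disclosure:
in every round `t` that an obedient receiver can reach (all earlier signals were NOT), given the
disclosed candidates `y` of the earlier rounds and the current signal `b`, no continuation strategy
`τ` gives the receiver a larger expected utility than obeying all signals from round `t` on.
Both sides are conditional expectations multiplied by the probability of the information set. -/
def PersuasiveDisclosure {n : ℕ} (φ : Mechanism n) (θ : Instance n) : Prop :=
  ∀ (t : Fin n) (y : Fin n → Candidate) (b : Bool) (τ : DisclosureStrategy n),
    expect φ θ (fun x s =>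
        if (∀ i, i < t → x i = y i ∧ s i = false) ∧ s t = b
        then payoff rho t (fun r => τ r (fun i => x i) (fun i => s i)) x else 0) ≤
      expect φ θ (fun x s =>
        if (∀ i, i < t → x i = y i ∧ s i = false) ∧ s t = b
        then payoff rho t s x else 0)

open Classical in
/-- `φ` is persuasive for the instance `θ` in the scenario without disclosure: the same condition,
where the receiver observes only the signals. -/
def PersuasiveNoDisclosure {n : ℕ} (φ : Mechanism n) (θ : Instance n) : Prop :=
  ∀ (t : Fin n) (b : Bool) (τ : NoDisclosureStrategy n),
    expect φ θ (fun x s =>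
        if (∀ i, i < t → s i = false) ∧ s t = b
        then payoff rho t (fun r => τ r (fun i => s i)) x else 0) ≤
      expect φ θ (fun x s =>
        if (∀ i, i < t → s i = false) ∧ s t = b
        then payoff rho t s x else 0)

/-- Persuasive in the secretary scenario with disclosure: the sender does not know the valuation
pairs, so one and the same mechanism has to be persuasive whatever the instance is. -/
def SecretaryPersuasive {n : ℕ} (φ : Mechanism n) : Prop :=
  ∀ θ : Instance n, PersuasiveDisclosure φ θ

/-- The sender's expected utility from `φ` on `θ` when the receiver is obedient. -/
def senderUtility {n : ℕ} (φ : Mechanism n) (θ : Instance n) : ℝ :=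
  expect φ θ (fun x s => payoff xi 0 s x)

open Classical in
/-- The sender's success probability: the probability that, under an obedient receiver, the hired
candidate has the largest sender value in `θ`. -/
def successProb {n : ℕ} (φ : Mechanism n) (θ : Instance n) : ℝ :=
  expect φ θ (fun x s => payoff (fun c => if ∀ j, xi (θ j) ≤ xi c then 1 else 0) 0 s x)

/-- The success probabilities achievable in the benchmark (basic scenario without disclosure), where
the sender knows `θ` and the mechanism only has to be persuasive for `θ`. -/
def benchmarkSuccesses {n : ℕ} (θ : Instance n) : Set ℝ :=
  {v | ∃ φ : Mechanism n, PersuasiveNoDisclosure φ θ ∧ v = successProb φ θ}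

/-- The expected sender utilities achievable in the benchmark. -/
def benchmarkUtilities {n : ℕ} (θ : Instance n) : Set ℝ :=
  {v | ∃ φ : Mechanism n, PersuasiveNoDisclosure φ θ ∧ v = senderUtility φ θ}

/-- `OPT` for ordinal sender utility. -/
def optSuccess {n : ℕ} (θ : Instance n) : ℝ := sSup (benchmarkSuccesses θ)

/-- `OPT` for cardinal sender utility. -/
def optUtility {n : ℕ} (θ : Instance n) : ℝ := sSup (benchmarkUtilities θ)

/-- Instance I: one candidate `a = (0, 1)`, one `b = (1, 0)`, and `n - 2` copies of
`c = (1/2, 0)`. -/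
def instanceI (n : ℕ) : Instance n := fun i =>
  if (i : ℕ) = 0 then (0, 1) else if (i : ℕ) = 1 then (1, 0) else (1 / 2, 0)

/-- Instance II: one candidate `a = (0, 1)` and `n - 1` copies of `c = (1/2, 0)`. -/
def instanceII (n : ℕ) : Instance n := fun i =>
  if (i : ℕ) = 0 then (0, 1) else (1 / 2, 0)

/-- The mechanism that always signals HIRE, so that an obedient receiver hires in round 1. -/
def hireFirst (n : ℕ) : Mechanism n := ⟨fun _ _ _ => 1⟩

end

end OnlinePersuasion

open OnlinePersuasion

/-! Whether an obedient receiver hires in round `t` depends only on the candidates seen up to round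
`t`. Averaging, over all rounds `r ≥ t`, the constraint that she does not gain by waiting for round
`r` shows that among the remaining candidates the hiring probability is non-negatively correlated
with `ρ`. In instance I this means that, if `a` arrives in round `t`, it is hired with at most the
probability with which any remaining candidate would be hired in its place: once `b` has passed,
only `a` and copies of `c` remain; before that, `c` lies halfway between `a` and `b`, which compares
`a` with `b`; and as long as only copies of `c` have passed, the sender cannot exclude instance II,
which compares `a` with `c`. Exchanging `a` with the candidate of the last round therefore charges
every success to an arrival order in which `a` comes last, an event of probability `1 / n`.

In the benchmark, the receiver gets at least the average `1 / 2` of `ρ`, while hiring `a` is worth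
nothing to her, so `a` is hired with probability at most `1 / 2`. Hiring the first of `a` and `b`
attains this bound by the symmetry between `a` and `b`. -/

namespace OnlinePersuasion

open Finset Equiv

variable {n : ℕ}

/-- The conditional probability of the signal `s t` of round `t`, given the earlier signals. -/
noncomputable def signalFactor (φ : Mechanism n) (x : Fin n → Candidate) (s : Fin n → Bool)
    (t : Fin n) : ℝ :=
  if s t = true then (φ.hireProb t (fun i => x i) (fun i => s i) : ℝ)
  else 1 - (φ.hireProb t (fun i => x i) (fun i => s i) : ℝ)

theorem signalProb_eq_prod (φ : Mechanism n) (x : Fin n → Candidate) (s : Fin n → Bool) :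
    signalProb φ x s = ∏ t, signalFactor φ x s t := rfl

theorem signalFactor_nonneg (φ : Mechanism n) (x : Fin n → Candidate) (s : Fin n → Bool)
    (t : Fin n) : 0 ≤ signalFactor φ x s t := by
  unfold signalFactor
  split_ifs
  · exact unitInterval.nonneg _
  · exact unitInterval.one_minus_nonneg _

theorem signalProb_nonneg (φ : Mechanism n) (x : Fin n → Candidate) (s : Fin n → Bool) :
    0 ≤ signalProb φ x s :=
  prod_nonneg fun t _ => signalFactor_nonneg φ x s t

theorem signalFactor_congr (φ : Mechanism n) {x x' : Fin n → Candidate} {s s' : Fin n → Bool}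
    {t : Fin n} (hx : ∀ i ≤ t, x i = x' i) (hs : ∀ i ≤ t, s i = s' i) :
    signalFactor φ x s t = signalFactor φ x' s' t := by
  have hx' : (fun i : Set.Iic t => x i) = fun i : Set.Iic t => x' i := funext fun i => hx i i.2
  have hs' : (fun i : Set.Iio t => s i) = fun i : Set.Iio t => s' i :=
    funext fun i => hs i (le_of_lt i.2)
  simp only [signalFactor, hx', hs', hs t le_rfl]

theorem signalFactor_update_true_add_false (φ : Mechanism n) (x : Fin n → Candidate)
    (s : Fin n → Bool) (t : Fin n) :
    signalFactor φ x (Function.update s t true) t +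
      signalFactor φ x (Function.update s t false) t = 1 := by
  have hpast (b : Bool) :
      (fun i : Set.Iio t => Function.update s t b i) = fun i : Set.Iio t => s i :=
    funext fun i => Function.update_of_ne (ne_of_lt i.2) _ _
  simp [signalFactor, hpast]

theorem prod_insert_signalFactor_update (φ : Mechanism n) (x : Fin n → Candidate)
    (s : Fin n → Bool) {S : Finset (Fin n)} (hS : IsLowerSet (S : Set (Fin n))) {t : Fin n}
    (ht : t ∉ S) (b : Bool) :
    ∏ i ∈ insert t S, signalFactor φ x (Function.update s t b) i =
      signalFactor φ x (Function.update s t b) t * ∏ i ∈ S, signalFactor φ x s i := by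
  rw [prod_insert ht]
  congr 1
  refine prod_congr rfl fun i hi => signalFactor_congr φ (fun _ _ => rfl) fun j hj => ?_
  exact Function.update_of_ne (ne_of_mem_of_not_mem (hS hj hi) ht) _ _

theorem sum_signalProb_of_agree (φ : Mechanism n) (x : Fin n → Candidate) (s₀ : Fin n → Bool)
    (S : Finset (Fin n)) (hS : IsLowerSet (S : Set (Fin n))) :
    ∑ s with ∀ i ∈ S, s i = s₀ i, signalProb φ x s = ∏ i ∈ S, signalFactor φ x s₀ i := by
  induction hm : #Sᶜ generalizing S s₀ with
  | zero =>
    obtain rfl : S = univ := by simpa using hm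
    simp [← funext_iff, signalProb_eq_prod, filter_eq']
  | succ m ih =>
    obtain ⟨t, ht⟩ := exists_minimal (card_pos.mp (by omega : 0 < #Sᶜ))
    have htS : t ∉ S := mem_compl.mp ht.prop
    have hlower : IsLowerSet (insert t S : Set (Fin n)) := by
      rintro i j hji (rfl | hi)
      · by_contra hj
        simp only [Set.mem_insert_iff, mem_coe, not_or] at hj
        exact hj.1 (hji.antisymm (ht.le_of_le (mem_compl.mpr hj.2) hji))
      · exact .inr (hS hji hi)
    have hcard : #(insert t S)ᶜ = m := by
      rw [compl_insert, card_erase_of_mem ht.prop, hm, Nat.add_sub_cancel]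
    have hagree (b : Bool) (s : Fin n → Bool) :
        (∀ i ∈ insert t S, s i = Function.update s₀ t b i) ↔ (∀ i ∈ S, s i = s₀ i) ∧ s t = b := by
      have hne (i) (hi : i ∈ S) : Function.update s₀ t b i = s₀ i :=
        Function.update_of_ne (ne_of_mem_of_not_mem hi htS) _ _
      simp +contextual only [forall_mem_insert, Function.update_self, hne, and_comm]
    have hstep (b : Bool) :
        ∑ s with (∀ i ∈ S, s i = s₀ i) ∧ s t = b, signalProb φ x s =
          signalFactor φ x (Function.update s₀ t b) t * ∏ i ∈ S, signalFactor φ x s₀ i := by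
      rw [← prod_insert_signalFactor_update φ x s₀ hS htS, ← ih _ _ (by simpa using hlower) hcard]
      simp only [hagree]
    rw [← sum_filter_add_sum_filter_not _ fun s => s t = true]
    simp only [filter_filter, Bool.not_eq_true, hstep, ← add_mul,
      signalFactor_update_true_add_false, one_mul]

theorem sum_signalProb (φ : Mechanism n) (x : Fin n → Candidate) :
    ∑ s, signalProb φ x s = 1 := by
  simpa using sum_signalProb_of_agree φ x (fun _ => false) ∅ (by simp [IsLowerSet])

/-- Round `r` is the first round `≥ start` in which the decision `d` is to hire. -/
def IsFirstHire (start : ℕ) (d : Fin n → Bool) (r : Fin n) : Prop :=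
  start ≤ (r : ℕ) ∧ d r = true ∧ ∀ q : Fin n, start ≤ (q : ℕ) → q < r → d q = false

theorem IsFirstHire.unique {start : ℕ} {d : Fin n → Bool} {r r' : Fin n}
    (h : IsFirstHire start d r) (h' : IsFirstHire start d r') : r = r' := by
  rcases lt_trichotomy r r' with hlt | heq | hgt
  · simpa [h.2.1] using h'.2.2 r h.1 hlt
  · exact heq
  · simpa [h'.2.1] using h.2.2 r' h'.1 hgt

theorem exists_isFirstHire {start : ℕ} {d : Fin n → Bool}
    (h : ∃ r : Fin n, start ≤ (r : ℕ) ∧ d r = true) : ∃ r, IsFirstHire start d r := by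
  obtain ⟨r, ⟨hr, hd⟩, hmin⟩ := wellFounded_lt.has_min {r : Fin n | start ≤ (r : ℕ) ∧ d r = true} h
  exact ⟨r, hr, hd, fun q hq hlt => by_contra fun hne => hmin q ⟨hq, by simpa using hne⟩ hlt⟩

theorem isFirstHire_val_iff {d : Fin n → Bool} {t : Fin n} :
    IsFirstHire t d t ↔ d t = true :=
  ⟨fun h => h.2.1, fun h => ⟨le_rfl, h, fun _ hq hlt => absurd hlt (not_lt.mpr hq)⟩⟩

theorem isFirstHire_zero_iff_forall_mem_Iic {s : Fin n → Bool} {t : Fin n} :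
    IsFirstHire 0 s t ↔ ∀ i ∈ Iic t, s i = decide (i = t) := by
  constructor
  · rintro ⟨-, ht, hbefore⟩ i hi
    rcases (mem_Iic.mp hi).lt_or_eq with hlt | rfl
    · simp [hbefore i (Nat.zero_le _) hlt, hlt.ne]
    · simp [ht]
  · intro h
    refine ⟨Nat.zero_le _, by simpa using h t (mem_Iic.mpr le_rfl), fun i _ hi => ?_⟩
    simpa [hi.ne] using h i (mem_Iic.mpr hi.le)

open Classical in
theorem payoff_eq_sum (u : Candidate → ℝ) (start : ℕ) (d : Fin n → Bool) (x : Fin n → Candidate) :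
    payoff u start d x = ∑ r, if IsFirstHire start d r then u (x r) else 0 :=
  sum_congr rfl fun _ _ => if_congr Iff.rfl rfl rfl

theorem IsFirstHire.payoff_eq {start : ℕ} {d : Fin n → Bool} {r : Fin n}
    (h : IsFirstHire start d r) (u : Candidate → ℝ) (x : Fin n → Candidate) :
    payoff u start d x = u (x r) := by
  rw [payoff_eq_sum, sum_eq_single r (fun q _ hne => if_neg fun hq => hne (hq.unique h)) (by simp),
    if_pos h]

theorem payoff_eq_zero {start : ℕ} {d : Fin n → Bool} (h : ¬ ∃ r, IsFirstHire start d r)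
    (u : Candidate → ℝ) (x : Fin n → Candidate) : payoff u start d x = 0 :=
  sum_eq_zero fun r _ => if_neg fun hr => h ⟨r, hr⟩

theorem payoff_add_payoff_le {u v : Candidate → ℝ} {x y : Fin n → Candidate} {C : ℝ}
    (hC : 0 ≤ C) (h : ∀ r, u (x r) + v (y r) ≤ C) (start : ℕ) (d : Fin n → Bool) :
    payoff u start d x + payoff v start d y ≤ C := by
  by_cases hd : ∃ r, IsFirstHire start d r
  · obtain ⟨r, hr⟩ := hd
    rw [hr.payoff_eq, hr.payoff_eq]
    exact h r
  · simpa only [payoff_eq_zero hd, add_zero] using hC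

open Classical in
/-- The probability that `φ` sends its first HIRE signal in round `t`, when the candidates arrive
in the sequence `x`. -/
noncomputable def firstHireProb (φ : Mechanism n) (x : Fin n → Candidate) (t : Fin n) : ℝ :=
  ∑ s with IsFirstHire 0 s t, signalProb φ x s

theorem firstHireProb_nonneg (φ : Mechanism n) (x : Fin n → Candidate) (t : Fin n) :
    0 ≤ firstHireProb φ x t :=
  sum_nonneg fun s _ => signalProb_nonneg φ x s

theorem sum_firstHireProb_le_one (φ : Mechanism n) (x : Fin n → Candidate) :
    ∑ t, firstHireProb φ x t ≤ 1 := by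
  classical
  have hdisj : (↑(univ : Finset (Fin n)) : Set (Fin n)).PairwiseDisjoint
      fun t => univ.filter (fun s : Fin n → Bool => IsFirstHire 0 s t) := fun t _ t' _ hne =>
    disjoint_filter.mpr fun _ _ h h' => hne (h.unique h')
  simp only [firstHireProb]
  rw [← sum_signalProb φ x, ← sum_biUnion hdisj]
  exact sum_le_univ_sum_of_nonneg fun s => signalProb_nonneg φ x s

theorem firstHireProb_eq_prod (φ : Mechanism n) (x : Fin n → Candidate) (t : Fin n) :
    firstHireProb φ x t = ∏ i ∈ Iic t, signalFactor φ x (fun i => decide (i = t)) i := by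
  classical
  rw [← sum_signalProb_of_agree φ x _ _ (by simpa using isLowerSet_Iic t), firstHireProb]
  exact sum_congr (filter_congr fun s _ => isFirstHire_zero_iff_forall_mem_Iic) fun _ _ => rfl

theorem firstHireProb_congr (φ : Mechanism n) {x x' : Fin n → Candidate} {t : Fin n}
    (h : ∀ i ≤ t, x i = x' i) : firstHireProb φ x t = firstHireProb φ x' t := by
  rw [firstHireProb_eq_prod, firstHireProb_eq_prod]
  exact prod_congr rfl fun i hi =>
    signalFactor_congr φ (fun j hj => h j (hj.trans (mem_Iic.mp hi))) fun _ _ => rfl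

/-- The probability that `φ` sends its first HIRE signal in round `t`, when the candidates `y` of
the earlier rounds are followed by the candidate `c`; the values of `y` from round `t` on play no
role. -/
noncomputable def firstHireProbOf (φ : Mechanism n) (y : Fin n → Candidate) (t : Fin n)
    (c : Candidate) : ℝ :=
  firstHireProb φ (Function.update y t c) t

theorem firstHireProb_eq_firstHireProbOf (φ : Mechanism n) {x y : Fin n → Candidate} {t : Fin n}
    (h : ∀ i < t, x i = y i) : firstHireProb φ x t = firstHireProbOf φ y t (x t) := by
  refine firstHireProb_congr φ fun i hi => ?_
  rcases hi.lt_or_eq with hlt | rfl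
  · rw [Function.update_of_ne hlt.ne, h i hlt]
  · rw [Function.update_self]

theorem firstHireProbOf_congr (φ : Mechanism n) {y y' : Fin n → Candidate} {t : Fin n}
    (h : ∀ i < t, y i = y' i) (c : Candidate) :
    firstHireProbOf φ y t c = firstHireProbOf φ y' t c := by
  refine (firstHireProb_eq_firstHireProbOf φ fun i hi => ?_).trans (by rw [Function.update_self])
  rw [Function.update_of_ne hi.ne, h i hi]

theorem card_mul_sum_perm_apply {α : Type*} [DecidableEq α] {S : Finset (Perm α)} {T : Finset α}
    {t : α} (hS : ∀ r ∈ T, ∀ π ∈ S, π * swap t r ∈ S) (g : α → ℝ) :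
    (#T : ℝ) * ∑ π ∈ S, g (π t) = ∑ π ∈ S, ∑ r ∈ T, g (π r) := by
  rw [sum_comm, ← nsmul_eq_mul, ← sum_const]
  refine sum_congr rfl fun r hr => ?_
  exact sum_nbij' (· * swap t r) (· * swap t r) (hS r hr) (hS r hr)
    (by simp [mul_assoc]) (by simp [mul_assoc]) (by simp)

theorem sum_perm_apply_div_factorial (g : Fin n → ℝ) (t : Fin n) :
    (∑ π : Perm (Fin n), g (π t)) / (n.factorial : ℝ) = (∑ i, g i) / n := by
  have havg := card_mul_sum_perm_apply (S := univ) (T := univ) (t := t) (by simp) g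
  have hn : (n : ℝ) ≠ 0 := by have := t.pos; positivity
  simp only [Equiv.sum_comp _ g, sum_const, card_univ, Fintype.card_perm, Fintype.card_fin,
    nsmul_eq_mul] at havg
  field_simp
  linarith

theorem expect_add (φ : Mechanism n) (θ : Instance n)
    (f g : (Fin n → Candidate) → (Fin n → Bool) → ℝ) :
    expect φ θ (fun x s => f x s + g x s) = expect φ θ f + expect φ θ g := by
  simp only [expect, mul_add, sum_add_distrib, add_div]

theorem expect_apply (φ : Mechanism n) (θ : Instance n) (u : Candidate → ℝ) (t : Fin n) :
    expect φ θ (fun x _ => u (x t)) = (∑ i, u (θ i)) / n := by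
  simp only [expect, ← sum_mul, sum_signalProb, one_mul]
  exact sum_perm_apply_div_factorial (fun i => u (θ i)) t

/-- The probability that the candidate with index `j` is hired by an obedient receiver. -/
noncomputable def hiredProb (φ : Mechanism n) (θ : Instance n) (j : Fin n) : ℝ :=
  (∑ π : Perm (Fin n), firstHireProb φ (θ ∘ π) (π.symm j)) / (n.factorial : ℝ)

theorem hiredProb_nonneg (φ : Mechanism n) (θ : Instance n) (j : Fin n) : 0 ≤ hiredProb φ θ j :=
  div_nonneg (sum_nonneg fun _ _ => firstHireProb_nonneg _ _ _) (Nat.cast_nonneg _)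

theorem sum_hiredProb_le_one (φ : Mechanism n) (θ : Instance n) : ∑ j, hiredProb φ θ j ≤ 1 := by
  simp only [hiredProb]
  rw [← sum_div, sum_comm, div_le_one (by positivity)]
  calc ∑ π : Perm (Fin n), ∑ j, firstHireProb φ (θ ∘ π) (π.symm j)
      = ∑ π : Perm (Fin n), ∑ t, firstHireProb φ (θ ∘ π) t :=
        sum_congr rfl fun π _ => Equiv.sum_comp π.symm _
    _ ≤ ∑ _π : Perm (Fin n), (1 : ℝ) := sum_le_sum fun π _ => sum_firstHireProb_le_one φ _
    _ = n.factorial := by simp [Fintype.card_perm]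

theorem expect_payoff_eq_sum_hiredProb (φ : Mechanism n) (θ : Instance n) (u : Candidate → ℝ) :
    expect φ θ (fun x s => payoff u 0 s x) = ∑ j, hiredProb φ θ j * u (θ j) := by
  classical
  have hsum (x : Fin n → Candidate) :
      ∑ s, signalProb φ x s * payoff u 0 s x = ∑ t, firstHireProb φ x t * u (x t) := by
    simp only [payoff_eq_sum, firstHireProb, mul_sum, sum_mul, sum_filter, ite_mul, zero_mul,
      mul_ite, mul_zero]
    exact sum_comm
  simp only [expect, hsum, hiredProb, div_mul_eq_mul_div, sum_mul]
  rw [← sum_div, sum_comm (t := univ (α := Perm (Fin n)))]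
  congr 1
  refine sum_congr rfl fun π _ => ?_
  rw [← Equiv.sum_comp π.symm]
  simp

/-- If the hiring probability never drops when `j` is exchanged with the candidate of round `l`,
then each outcome in which `j` is hired can be charged to an arrival order with `j` in round `l`. -/
theorem hiredProb_le_one_div_of_exchange {φ : Mechanism n} {θ : Instance n} {j : Fin n} (l : Fin n)
    (h : ∀ (π : Perm (Fin n)) (t : Fin n), π t = j →
      firstHireProb φ (θ ∘ π) t ≤ firstHireProb φ (θ ∘ (π * swap t l : Perm (Fin n))) t) :
    hiredProb φ θ j ≤ 1 / n := by
  have hlast : (∑ π : Perm (Fin n), if π l = j then (1 : ℝ) else 0) / n.factorial = 1 / n := by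
    simpa using sum_perm_apply_div_factorial (fun i => if i = j then 1 else 0) l
  rw [hiredProb, ← hlast]
  gcongr ?_ / _
  calc ∑ π : Perm (Fin n), firstHireProb φ (θ ∘ π) (π.symm j)
      = ∑ t, ∑ π : Perm (Fin n), if π t = j then firstHireProb φ (θ ∘ π) t else 0 := by
        rw [sum_comm]
        simp [← Equiv.eq_symm_apply]
    _ ≤ ∑ t, ∑ π : Perm (Fin n), if π t = j then
          firstHireProb φ (θ ∘ (π * swap t l : Perm (Fin n))) t else 0 := by
        gcongr with t _ π _
        split_ifs with hπ
        exacts [h π t hπ, le_rfl]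
    _ = ∑ t, ∑ π : Perm (Fin n), if π l = j then firstHireProb φ (θ ∘ π) t else 0 := by
        refine sum_congr rfl fun t _ => ?_
        rw [← Equiv.sum_comp (Equiv.mulRight (swap t l))
          (fun π => if π l = j then firstHireProb φ (θ ∘ π) t else 0)]
        simp
    _ ≤ ∑ π : Perm (Fin n), if π l = j then 1 else 0 := by
        rw [sum_comm]
        gcongr with π _
        split_ifs
        exacts [sum_firstHireProb_le_one φ _, sum_const_zero.le]

/-- The arrival orders of `θ` that show the candidates `y` in the rounds before `t`. -/
noncomputable def ordersWithPrefix (θ : Instance n) (y : Fin n → Candidate) (t : Fin n) :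
    Finset (Perm (Fin n)) :=
  {π | ∀ i < t, θ (π i) = y i}

theorem sum_Ici_eq_of_mem_ordersWithPrefix {θ : Instance n} {π₀ π : Perm (Fin n)} {t : Fin n}
    (hπ : π ∈ ordersWithPrefix θ (θ ∘ π₀) t) (g : Candidate → ℝ) :
    ∑ r ∈ Ici t, g (θ (π r)) = ∑ r ∈ Ici t, g (θ (π₀ r)) := by
  have hsplit (σ : Perm (Fin n)) :
      ∑ r ∈ Iio t, g (θ (σ r)) + ∑ r ∈ Ici t, g (θ (σ r)) = ∑ i, g (θ i) := by
    have hcompl : Ici t = (Iio t)ᶜ := by ext; simp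
    rw [hcompl, sum_add_sum_compl, Equiv.sum_comp σ fun i => g (θ i)]
  have hprefix : ∑ r ∈ Iio t, g (θ (π r)) = ∑ r ∈ Iio t, g (θ (π₀ r)) :=
    sum_congr rfl fun r hr => congrArg g ((mem_filter.mp hπ).2 r (mem_Iio.mp hr))
  linarith [hsplit π, hsplit π₀]

theorem mul_swap_mem_ordersWithPrefix {θ : Instance n} {y : Fin n → Candidate} {π : Perm (Fin n)}
    {t r : Fin n} (hr : t ≤ r) (hπ : π ∈ ordersWithPrefix θ y t) :
    π * swap t r ∈ ordersWithPrefix θ y t := by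
  refine mem_filter.mpr ⟨mem_univ _, fun i hi => ?_⟩
  rw [Perm.mul_apply, swap_apply_of_ne_of_ne hi.ne (hi.trans_le hr).ne]
  exact (mem_filter.mp hπ).2 i hi

theorem card_Ici_mul_sum_ordersWithPrefix (θ : Instance n) (π₀ : Perm (Fin n)) (t : Fin n)
    (g : Candidate → ℝ) :
    (#(Ici t) : ℝ) * ∑ π ∈ ordersWithPrefix θ (θ ∘ π₀) t, g (θ (π t)) =
      #(ordersWithPrefix θ (θ ∘ π₀) t) * ∑ r ∈ Ici t, g (θ (π₀ r)) := by
  rw [card_mul_sum_perm_apply (T := Ici t)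
      (fun r hr _ => mul_swap_mem_ordersWithPrefix (mem_Ici.mp hr)) fun i => g (θ i),
    sum_congr rfl fun π hπ => sum_Ici_eq_of_mem_ordersWithPrefix hπ g, sum_const, nsmul_eq_mul]

open Classical in
theorem expect_of_first_hire_after_prefix (φ : Mechanism n) (θ : Instance n)
    (y : Fin n → Candidate) (t : Fin n) (w : (Fin n → Candidate) → ℝ) :
    expect φ θ (fun x s =>
        if (∀ i, i < t → x i = y i ∧ s i = false) ∧ s t = true then w x else 0) =
      (∑ π ∈ ordersWithPrefix θ y t, firstHireProbOf φ y t (θ (π t)) * w (θ ∘ π)) /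
        (n.factorial : ℝ) := by
  rw [expect, ordersWithPrefix, sum_filter]
  congr 1
  refine sum_congr rfl fun π _ => ?_
  split_ifs with hπ
  · have hp : firstHireProb φ (θ ∘ π) t = firstHireProbOf φ y t (θ (π t)) :=
      firstHireProb_eq_firstHireProbOf φ hπ
    rw [← hp, firstHireProb, sum_mul, sum_filter]
    refine sum_congr rfl fun s _ => ?_
    have hs : ((∀ i, i < t → (θ ∘ π) i = y i ∧ s i = false) ∧ s t = true) ↔ IsFirstHire 0 s t :=
      ⟨fun h => ⟨Nat.zero_le _, h.2, fun i _ hi => (h.1 i hi).2⟩,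
        fun h => ⟨fun i hi => ⟨hπ i hi, h.2.2 i (Nat.zero_le _) hi⟩, h.2.1⟩⟩
    simp only [hs, mul_ite, mul_zero]
  · exact sum_eq_zero fun s _ => by
      rw [if_neg fun h => hπ fun i hi => (h.1 i hi).1, mul_zero]

theorem PersuasiveDisclosure.sum_mul_rho_le {φ : Mechanism n} {θ : Instance n}
    (h : PersuasiveDisclosure φ θ) (y : Fin n → Candidate) {t r : Fin n} (hr : t ≤ r) :
    ∑ π ∈ ordersWithPrefix θ y t, firstHireProbOf φ y t (θ (π t)) * rho (θ (π r)) ≤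
      ∑ π ∈ ordersWithPrefix θ y t, firstHireProbOf φ y t (θ (π t)) * rho (θ (π t)) := by
  have hwait := h t y true fun q _ _ => decide (q = r)
  have hdeviate (x : Fin n → Candidate) :
      payoff rho t (fun q => decide (q = r)) x = rho (x r) :=
    IsFirstHire.payoff_eq ⟨hr, by simp, fun q _ hq => by simp [hq.ne]⟩ rho x
  have hobey (x : Fin n → Candidate) (s : Fin n → Bool) (hs : s t = true) :
      payoff rho t s x = rho (x t) :=
    (isFirstHire_val_iff.mpr hs).payoff_eq rho x
  simp +contextual only [hdeviate, hobey] at hwait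
  rw [expect_of_first_hire_after_prefix, expect_of_first_hire_after_prefix] at hwait
  exact (div_le_div_iff_of_pos_right (by positivity)).mp hwait

/-- Among the candidates that may arrive in round `t`, the hiring probability and the receiver's
value are non-negatively correlated: average the constraint against waiting for round `r` over all
`r ≥ t`. -/
theorem PersuasiveDisclosure.sum_mul_sum_rho_le {φ : Mechanism n} {θ : Instance n}
    (h : PersuasiveDisclosure φ θ) (π₀ : Perm (Fin n)) (t : Fin n) :
    (∑ r ∈ Ici t, firstHireProbOf φ (θ ∘ π₀) t (θ (π₀ r))) * ∑ r ∈ Ici t, rho (θ (π₀ r)) ≤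
      #(Ici t) * ∑ r ∈ Ici t, firstHireProbOf φ (θ ∘ π₀) t (θ (π₀ r)) * rho (θ (π₀ r)) := by
  set p := firstHireProbOf φ (θ ∘ π₀) t
  set S := ordersWithPrefix θ (θ ∘ π₀) t
  set R := ∑ r ∈ Ici t, rho (θ (π₀ r))
  have hS : (0 : ℝ) < #S :=
    Nat.cast_pos.mpr (card_pos.mpr ⟨π₀, mem_filter.mpr ⟨mem_univ _, fun _ _ => rfl⟩⟩)
  have hwait : (∑ π ∈ S, p (θ (π t))) * R ≤
      #(Ici t) * ∑ π ∈ S, p (θ (π t)) * rho (θ (π t)) :=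
    calc (∑ π ∈ S, p (θ (π t))) * R
        = ∑ r ∈ Ici t, ∑ π ∈ S, p (θ (π t)) * rho (θ (π r)) := by
          rw [sum_comm, sum_mul]
          refine sum_congr rfl fun π hπ => ?_
          rw [← mul_sum, sum_Ici_eq_of_mem_ordersWithPrefix hπ]
      _ ≤ ∑ _r ∈ Ici t, ∑ π ∈ S, p (θ (π t)) * rho (θ (π t)) :=
          sum_le_sum fun r hr => h.sum_mul_rho_le _ (mem_Ici.mp hr)
      _ = #(Ici t) * ∑ π ∈ S, p (θ (π t)) * rho (θ (π t)) := by rw [sum_const, nsmul_eq_mul]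
  have hp := card_Ici_mul_sum_ordersWithPrefix θ π₀ t p
  have hpρ := card_Ici_mul_sum_ordersWithPrefix θ π₀ t fun c => p c * rho c
  refine le_of_mul_le_mul_left ?_ hS
  calc #S * ((∑ r ∈ Ici t, p (θ (π₀ r))) * R)
      = #(Ici t) * ((∑ π ∈ S, p (θ (π t))) * R) := by rw [← mul_assoc, ← hp, mul_assoc]
    _ ≤ #(Ici t) * (#(Ici t) * ∑ π ∈ S, p (θ (π t)) * rho (θ (π t))) := by gcongr
    _ = #S * (#(Ici t) * ∑ r ∈ Ici t, p (θ (π₀ r)) * rho (θ (π₀ r))) := by rw [hpρ]; ring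

theorem PersuasiveDisclosure.firstHireProbOf_le_of_two_values {φ : Mechanism n} {θ : Instance n}
    (h : PersuasiveDisclosure φ θ) {π : Perm (Fin n)} {t l : Fin n} (hl : t < l)
    {u v : Candidate} (huv : rho u < rho v) (hu : θ (π t) = u) (hv : ∀ r, t < r → θ (π r) = v) :
    firstHireProbOf φ (θ ∘ π) t u ≤ firstHireProbOf φ (θ ∘ π) t v := by
  have hcorr := h.sum_mul_sum_rho_le π t
  have hsum (g : Candidate → ℝ) : ∑ r ∈ Ici t, g (θ (π r)) = g u + #(Ioi t) * g v := by
    rw [← Ioi_insert, sum_insert (by simp), hu, ← nsmul_eq_mul, ← sum_const]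
    congr 1
    exact sum_congr rfl fun r hr => by rw [hv r (mem_Ioi.mp hr)]
  have hcard : (#(Ici t) : ℝ) = 1 + #(Ioi t) := by simpa using hsum fun _ => 1
  have hpos : (0 : ℝ) < #(Ioi t) := Nat.cast_pos.mpr (card_pos.mpr ⟨l, mem_Ioi.mpr hl⟩)
  rw [hsum, hsum, hsum fun c => firstHireProbOf φ (θ ∘ π) t c * rho c, hcard] at hcorr
  by_contra! hlt
  nlinarith [mul_pos hpos (mul_pos (sub_pos.mpr huv) (sub_pos.mpr hlt))]

theorem PersuasiveDisclosure.firstHireProbOf_le_of_midpoint {φ : Mechanism n} {θ : Instance n}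
    (h : PersuasiveDisclosure φ θ) {π : Perm (Fin n)} {t l : Fin n} (hl : t < l)
    (hlt : rho (θ (π t)) < rho (θ (π l)))
    (hmid : ∀ r, t < r → r ≠ l → rho (θ (π r)) = (rho (θ (π t)) + rho (θ (π l))) / 2) :
    firstHireProbOf φ (θ ∘ π) t (θ (π t)) ≤ firstHireProbOf φ (θ ∘ π) t (θ (π l)) := by
  have hcorr := h.sum_mul_sum_rho_le π t
  set p := firstHireProbOf φ (θ ∘ π) t
  set M := (rho (θ (π t)) + rho (θ (π l))) / 2 with hM
  have hdev (g : Fin n → ℝ) : ∑ r ∈ Ici t, g r * (rho (θ (π r)) - M) =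
      (g l - g t) * ((rho (θ (π l)) - rho (θ (π t))) / 2) := by
    rw [← Ioi_insert, sum_insert (by simp), sum_eq_single_of_mem l (mem_Ioi.mpr hl)
      fun r hr hrl => by rw [hmid r (mem_Ioi.mp hr) hrl, sub_self, mul_zero], hM]
    ring
  have hmean : ∑ r ∈ Ici t, rho (θ (π r)) = #(Ici t) * M := by
    have := hdev fun _ => 1
    simp only [one_mul, sum_sub_distrib, sum_const, nsmul_eq_mul, sub_self, zero_mul] at this
    linarith
  have hcard : (0 : ℝ) < #(Ici t) := Nat.cast_pos.mpr (card_pos.mpr ⟨t, mem_Ici.mpr le_rfl⟩)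
  have hcov : 0 ≤ ∑ r ∈ Ici t, p (θ (π r)) * (rho (θ (π r)) - M) := by
    simp only [mul_sub, sum_sub_distrib, ← sum_mul]
    rw [hmean, mul_left_comm] at hcorr
    exact sub_nonneg.mpr (le_of_mul_le_mul_left hcorr hcard)
  rw [hdev fun r => p (θ (π r))] at hcov
  linarith [nonneg_of_mul_nonneg_left hcov (by linarith)]

/-- The mechanism that signals HIRE exactly upon the candidates that satisfy `p`. -/
noncomputable def hireWhen (n : ℕ) (p : Candidate → Bool) : Mechanism n :=
  ⟨fun t x _ => if p (x ⟨t, Set.mem_Iic.mpr le_rfl⟩) then 1 else 0⟩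

theorem hireFirst_eq_hireWhen : hireFirst n = hireWhen n fun _ => true := by
  simp [hireFirst, hireWhen]

theorem signalProb_hireWhen (p : Candidate → Bool) (x : Fin n → Candidate) (s : Fin n → Bool) :
    signalProb (hireWhen n p) x s = if s = p ∘ x then 1 else 0 := by
  have hfactor (t : Fin n) :
      signalFactor (hireWhen n p) x s t = if s t = p (x t) then 1 else 0 := by
    cases hs : s t <;> cases hp : p (x t) <;> simp [signalFactor, hireWhen, hs, hp]
  simp [signalProb_eq_prod, hfactor, prod_ite_zero, funext_iff]

theorem expect_hireWhen (p : Candidate → Bool) (θ : Instance n)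
    (f : (Fin n → Candidate) → (Fin n → Bool) → ℝ) :
    expect (hireWhen n p) θ f =
      (∑ π : Perm (Fin n), f (θ ∘ π) (p ∘ θ ∘ π)) / (n.factorial : ℝ) := by
  simp [expect, signalProb_hireWhen]

theorem two_mul_expect_hireWhen {p : Candidate → Bool} {θ : Instance n} {e : Perm (Fin n)}
    (he : ∀ i, p (θ (e i)) = p (θ i)) (f : (Fin n → Candidate) → (Fin n → Bool) → ℝ) :
    2 * expect (hireWhen n p) θ f =
      (∑ π : Perm (Fin n), (f (θ ∘ π) (p ∘ θ ∘ π) + f (θ ∘ e ∘ π) (p ∘ θ ∘ π))) /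
        (n.factorial : ℝ) := by
  have hsignals (π : Perm (Fin n)) : p ∘ θ ∘ e ∘ π = p ∘ θ ∘ π := funext fun r => he (π r)
  rw [expect_hireWhen, sum_add_distrib, two_mul, ← add_div]
  congr 2
  rw [← Equiv.sum_comp (Equiv.mulLeft e)]
  simp [hsignals]

/-- Exchanging candidates by `e` does not change the signals, so whichever round a deviation picks,
it earns on average half of `rho (θ i) + rho (θ (e i))`, which is largest for the candidates that
trigger HIRE. -/
theorem persuasiveNoDisclosure_hireWhen {p : Candidate → Bool} {θ : Instance n}
    {e : Perm (Fin n)} (he : ∀ i, p (θ (e i)) = p (θ i)) (hp : ∃ i, p (θ i) = true)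
    (hmax : ∀ i j, p (θ j) = true →
      rho (θ i) + rho (θ (e i)) ≤ rho (θ j) + rho (θ (e j))) :
    PersuasiveNoDisclosure (hireWhen n p) θ := by
  intro t b τ
  refine le_of_mul_le_mul_left ?_ two_pos
  rw [two_mul_expect_hireWhen he, two_mul_expect_hireWhen he]
  refine div_le_div_of_nonneg_right (sum_le_sum fun π _ => ?_) (Nat.cast_nonneg _)
  split_ifs with hevent
  · obtain ⟨i, hi⟩ := hp
    have hreach : t ≤ π.symm i := by
      by_contra! hlt
      simpa [hi] using hevent.1 _ hlt
    obtain ⟨r, hr⟩ := exists_isFirstHire (start := t) (d := p ∘ θ ∘ π)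
      ⟨π.symm i, hreach, by simpa using hi⟩
    rw [hr.payoff_eq, hr.payoff_eq]
    exact payoff_add_payoff_le (add_nonneg (NNReal.coe_nonneg _) (NNReal.coe_nonneg _))
      (fun q => hmax (π q) (π r) hr.2.1) _ _
  · exact le_rfl

theorem senderUtility_hireWhen {p : Candidate → Bool} {θ : Instance n} {e : Perm (Fin n)}
    (he : ∀ i, p (θ (e i)) = p (θ i)) (hp : ∃ i, p (θ i) = true) {C : ℝ}
    (hC : ∀ i, p (θ i) = true → xi (θ i) + xi (θ (e i)) = C) :
    senderUtility (hireWhen n p) θ = C / 2 := by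
  have hpair (π : Perm (Fin n)) :
      payoff xi 0 (p ∘ θ ∘ π) (θ ∘ π) + payoff xi 0 (p ∘ θ ∘ π) (θ ∘ e ∘ π) = C := by
    obtain ⟨i, hi⟩ := hp
    obtain ⟨r, hr⟩ := exists_isFirstHire (start := 0) (d := p ∘ θ ∘ π)
      ⟨π.symm i, Nat.zero_le _, by simpa using hi⟩
    rw [hr.payoff_eq, hr.payoff_eq]
    exact hC (π r) hr.2.1
  have htwo : 2 * senderUtility (hireWhen n p) θ = C := by
    rw [senderUtility, two_mul_expect_hireWhen he, sum_congr rfl fun π _ => hpair π]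
    have hfact : (n.factorial : ℝ) ≠ 0 := Nat.cast_ne_zero.mpr n.factorial_ne_zero
    rw [sum_const, card_univ, Fintype.card_perm, Fintype.card_fin, nsmul_eq_mul,
      mul_div_cancel_left₀ _ hfact]
  linarith

theorem senderUtility_hireFirst [NeZero n] (θ : Instance n) :
    senderUtility (hireFirst n) θ = (∑ i, xi (θ i)) / n := by
  have hfirst (x : Fin n → Candidate) : payoff xi 0 (fun _ => true) x = xi (x 0) :=
    IsFirstHire.payoff_eq ⟨Nat.zero_le _, rfl, fun _ _ hq => absurd hq (Fin.not_lt_zero _)⟩ xi x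
  rw [← expect_apply (hireFirst n) θ xi 0, senderUtility, hireFirst_eq_hireWhen,
    expect_hireWhen, expect_hireWhen]
  exact congrArg (· / _) (sum_congr rfl fun π _ => hfirst (θ ∘ π))

/-- The receiver may ignore the signals and hire in round 1. -/
theorem PersuasiveNoDisclosure.mean_rho_le [NeZero n] {φ : Mechanism n} {θ : Instance n}
    (h : PersuasiveNoDisclosure φ θ) :
    (∑ i, rho (θ i)) / n ≤ ∑ j, hiredProb φ θ j * rho (θ j) := by
  have hnone (i : Fin n) : ¬ i < 0 := Fin.not_lt_zero i
  have hfirst (x : Fin n → Candidate) :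
      payoff rho (0 : Fin n) (fun _ => true) x = rho (x 0) :=
    (isFirstHire_val_iff.mpr rfl).payoff_eq rho x
  have hdev := add_le_add (h 0 true fun _ _ => true) (h 0 false fun _ _ => true)
  have hcases (b : Bool) (v : ℝ) :
      (if b = true then v else 0) + (if b = false then v else 0) = v := by cases b <;> simp
  simp only [← expect_add, hnone, false_imp_iff, implies_true, true_and, hfirst, hcases] at hdev
  rw [← expect_payoff_eq_sum_hiredProb, ← expect_apply φ θ rho 0]
  exact hdev

theorem PersuasiveNoDisclosure.hiredProb_le_one_sub_mean_rho [NeZero n] {φ : Mechanism n}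
    {θ : Instance n} (h : PersuasiveNoDisclosure φ θ) (hle : ∀ i, rho (θ i) ≤ 1) {j : Fin n}
    (hj : rho (θ j) = 0) : hiredProb φ θ j ≤ 1 - (∑ i, rho (θ i)) / n := by
  have hreceiver : ∑ i, hiredProb φ θ i * rho (θ i) ≤ ∑ i ∈ univ.erase j, hiredProb φ θ i := by
    rw [← sum_erase univ (by rw [hj, mul_zero])]
    exact sum_le_sum fun i _ => mul_le_of_le_one_right (hiredProb_nonneg φ θ i) (hle i)
  have htotal := sum_hiredProb_le_one φ θ
  rw [← add_sum_erase univ _ (mem_univ j)] at htotal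
  linarith [h.mean_rho_le]

theorem instanceI_zero {i : Fin n} (h : (i : ℕ) = 0) : instanceI n i = (0, 1) := by
  simp [instanceI, h]

theorem instanceI_one {i : Fin n} (h : (i : ℕ) = 1) : instanceI n i = (1, 0) := by
  simp [instanceI, h]

theorem instanceI_of_two_le {i : Fin n} (h : 2 ≤ (i : ℕ)) : instanceI n i = (1 / 2, 0) := by
  rw [instanceI, if_neg (by omega), if_neg (by omega)]

theorem instanceII_zero {i : Fin n} (h : (i : ℕ) = 0) : instanceII n i = (0, 1) := by
  simp [instanceII, h]

theorem instanceII_of_ne_zero {i : Fin n} (h : (i : ℕ) ≠ 0) : instanceII n i = (1 / 2, 0) := by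
  simp [instanceII, h]

theorem rho_instanceI (i : Fin n) :
    rho (instanceI n i) = if (i : ℕ) = 0 then 0 else if (i : ℕ) = 1 then 1 else 1 / 2 := by
  unfold instanceI
  split_ifs <;> simp [rho]

theorem xi_instanceI [NeZero n] (i : Fin n) : xi (instanceI n i) = if i = 0 then 1 else 0 := by
  unfold instanceI
  simp only [Fin.val_eq_zero_iff]
  split_ifs <;> simp [xi]

theorem sum_xi_instanceI [NeZero n] : ∑ i, xi (instanceI n i) = 1 := by
  simp [xi_instanceI]

theorem senderUtility_instanceI [NeZero n] (φ : Mechanism n) :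
    senderUtility φ (instanceI n) = hiredProb φ (instanceI n) 0 := by
  simp [senderUtility, expect_payoff_eq_sum_hiredProb, xi_instanceI]

theorem successProb_instanceI [NeZero n] (φ : Mechanism n) :
    successProb φ (instanceI n) = senderUtility φ (instanceI n) := by
  have hbest (i : Fin n) : (∀ j, xi (instanceI n j) ≤ xi (instanceI n i)) ↔ i = 0 := by
    simp only [xi_instanceI]
    refine ⟨fun h => by_contra fun hi => ?_, fun hi j => ?_⟩
    · simpa [hi, not_le.mpr one_pos] using h 0
    · rw [if_pos hi]
      split_ifs <;> norm_num
  rw [senderUtility_instanceI, successProb, expect_payoff_eq_sum_hiredProb]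
  simp [hbest]

theorem benchmarkSuccesses_instanceI [NeZero n] :
    benchmarkSuccesses (instanceI n) = benchmarkUtilities (instanceI n) := by
  simp only [benchmarkSuccesses, benchmarkUtilities, successProb_instanceI]

theorem optSuccess_instanceI [NeZero n] :
    optSuccess (instanceI n) = optUtility (instanceI n) := by
  rw [optSuccess, benchmarkSuccesses_instanceI, optUtility]

theorem firstHireProbOf_instanceI_le {φ : Mechanism n}
    (hI : PersuasiveDisclosure φ (instanceI n)) (hII : PersuasiveDisclosure φ (instanceII n))
    {π : Perm (Fin n)} {t l : Fin n} (hl : t < l) (h0 : (π t : ℕ) = 0) :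
    firstHireProbOf φ (instanceI n ∘ π) t (instanceI n (π t)) ≤
      firstHireProbOf φ (instanceI n ∘ π) t (instanceI n (π l)) := by
  have hne {r r' : Fin n} (h : r ≠ r') : (π r : ℕ) ≠ π r' := fun e => h (π.injective (Fin.ext e))
  have hpos {r : Fin n} (hr : r ≠ t) : (π r : ℕ) ≠ 0 := h0 ▸ hne hr
  obtain ⟨k, hk⟩ : ∃ k, (π k : ℕ) = 1 := ⟨π.symm ⟨1, by omega⟩, by simp⟩
  have hc {r : Fin n} (hrt : r ≠ t) (hrk : r ≠ k) : instanceI n (π r) = (1 / 2, 0) :=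
    instanceI_of_two_le (by have := hpos hrt; have := hne hrk; omega)
  have hkt : k ≠ t := fun e => by subst e; omega
  have hac : rho (0, 1) < rho (1 / 2, 0) := by simp [rho]
  rcases hkt.lt_or_gt with hkt | hkt
  · rw [hc hl.ne' (hkt.trans hl).ne', instanceI_zero h0]
    exact hI.firstHireProbOf_le_of_two_values hl hac (instanceI_zero h0)
      fun r hr => hc hr.ne' (hkt.trans hr).ne'
  rcases eq_or_ne l k with rfl | hlk
  · refine hI.firstHireProbOf_le_of_midpoint hl ?_ fun r hr hrl => ?_
    · simp [rho_instanceI, h0, hk]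
    · rw [hc hr.ne' hrl, instanceI_zero h0, instanceI_one hk]
      simp [rho]
  · have hprefix : ∀ i < t, (instanceI n ∘ π) i = (instanceII n ∘ π) i := fun i hi => by
      simp only [Function.comp_apply, hc hi.ne (hi.trans hkt).ne,
        instanceII_of_ne_zero (hpos hi.ne)]
    rw [hc hl.ne' hlk, instanceI_zero h0, firstHireProbOf_congr φ hprefix,
      firstHireProbOf_congr φ hprefix]
    exact hII.firstHireProbOf_le_of_two_values hl hac (instanceII_zero h0)
      fun r hr => instanceII_of_ne_zero (hpos hr.ne')

theorem senderUtility_instanceI_le [NeZero n] {φ : Mechanism n}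
    (hI : PersuasiveDisclosure φ (instanceI n)) (hII : PersuasiveDisclosure φ (instanceII n)) :
    senderUtility φ (instanceI n) ≤ 1 / n := by
  rw [senderUtility_instanceI]
  refine hiredProb_le_one_div_of_exchange ⊤ fun π t ht => ?_
  rcases (le_top : t ≤ ⊤).eq_or_lt with rfl | hlast
  · simp
  have hbefore : ∀ i < t, (instanceI n ∘ (π * swap t ⊤ : Perm (Fin n))) i = (instanceI n ∘ π) i :=
    fun i hi => by simp [swap_apply_of_ne_of_ne hi.ne (hi.trans hlast).ne]
  rw [firstHireProb_eq_firstHireProbOf φ hbefore,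
    firstHireProb_eq_firstHireProbOf φ (x := instanceI n ∘ π) fun _ _ => rfl]
  simpa using firstHireProbOf_instanceI_le hI hII hlast (by simp [ht])

theorem rho_instanceI_add_rho_swap {a b : Fin n} (ha : (a : ℕ) = 0) (hb : (b : ℕ) = 1)
    (i : Fin n) : rho (instanceI n i) + rho (instanceI n (swap a b i)) = 1 := by
  rcases eq_or_ne i a with rfl | hia
  · simp [rho_instanceI, ha, hb]
  rcases eq_or_ne i b with rfl | hib
  · simp [rho_instanceI, ha, hb]
  rw [swap_apply_of_ne_of_ne hia hib, instanceI_of_two_le (by omega)]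
  norm_num [rho]

theorem xi_instanceI_add_xi_swap {a b : Fin n} (ha : (a : ℕ) = 0) (hb : (b : ℕ) = 1)
    {i : Fin n} (hi : rho (instanceI n i) ≠ 1 / 2) :
    xi (instanceI n i) + xi (instanceI n (swap a b i)) = 1 := by
  rcases eq_or_ne i a with rfl | hia
  · simp [instanceI_zero ha, instanceI_one hb, xi]
  rcases eq_or_ne i b with rfl | hib
  · simp [instanceI_zero ha, instanceI_one hb, xi]
  rw [instanceI_of_two_le (by omega)] at hi
  simp [rho] at hi

theorem mean_rho_instanceI (hn : 2 ≤ n) : (∑ i, rho (instanceI n i)) / n = 1 / 2 := by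
  have hpairs := Fintype.sum_congr _ _ <|
    rho_instanceI_add_rho_swap (n := n) (a := ⟨0, by omega⟩) (b := ⟨1, by omega⟩) rfl rfl
  rw [sum_add_distrib, Equiv.sum_comp _ fun i => rho (instanceI n i)] at hpairs
  have hn0 : (n : ℝ) ≠ 0 := by positivity
  simp only [sum_const, card_univ, Fintype.card_fin, nsmul_eq_mul] at hpairs
  field_simp
  linarith

theorem isGreatest_benchmarkUtilities_instanceI (hn : 2 ≤ n) :
    IsGreatest (benchmarkUtilities (instanceI n)) (1 / 2) := by
  have : NeZero n := ⟨by omega⟩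
  constructor
  · set p : Candidate → Bool := fun c => decide (rho c ≠ 1 / 2)
    obtain ⟨a, ha⟩ : ∃ a : Fin n, (a : ℕ) = 0 := ⟨⟨0, by omega⟩, rfl⟩
    obtain ⟨b, hb⟩ : ∃ b : Fin n, (b : ℕ) = 1 := ⟨⟨1, by omega⟩, rfl⟩
    have hpair := rho_instanceI_add_rho_swap ha hb
    have hsymm (i : Fin n) : p (instanceI n (swap a b i)) = p (instanceI n i) := by
      have hiff : rho (instanceI n (swap a b i)) = 1 / 2 ↔ rho (instanceI n i) = 1 / 2 :=
        ⟨fun h => by linarith [hpair i], fun h => by linarith [hpair i]⟩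
      simp only [p, ne_eq, hiff]
    have hhire : ∃ i, p (instanceI n i) = true := ⟨a, by simp [p, rho_instanceI, ha]⟩
    exact ⟨hireWhen n p,
      persuasiveNoDisclosure_hireWhen hsymm hhire fun i j _ => by rw [hpair, hpair],
      (senderUtility_hireWhen hsymm hhire fun i hi =>
        xi_instanceI_add_xi_swap ha hb (of_decide_eq_true hi)).symm⟩
  · rintro _ ⟨φ, hφ, rfl⟩
    have hle (i : Fin n) : rho (instanceI n i) ≤ 1 := by
      rw [rho_instanceI]
      split_ifs <;> norm_num
    have hbound := hφ.hiredProb_le_one_sub_mean_rho hle (j := 0) (by simp [rho_instanceI])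
    rw [mean_rho_instanceI hn] at hbound
    rw [senderUtility_instanceI]
    linarith

theorem senderUtility_hireFirst_instanceI [NeZero n] :
    senderUtility (hireFirst n) (instanceI n) = 1 / n := by
  rw [senderUtility_hireFirst, sum_xi_instanceI]

theorem isGreatest_benchmarkUtilities_instanceI_one :
    IsGreatest (benchmarkUtilities (instanceI 1)) 1 := by
  constructor
  · refine ⟨hireFirst 1, ?_, by simp [senderUtility_hireFirst_instanceI]⟩
    rw [hireFirst_eq_hireWhen]
    exact persuasiveNoDisclosure_hireWhen (e := 1) (fun _ => rfl) ⟨0, rfl⟩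
      fun i j _ => by rw [Subsingleton.elim i j]
  · rintro _ ⟨φ, -, rfl⟩
    simpa [senderUtility_instanceI] using sum_hiredProb_le_one φ (instanceI 1)

theorem one_half_le_optUtility_instanceI [NeZero n] : 1 / 2 ≤ optUtility (instanceI n) := by
  rcases (NeZero.one_le : 1 ≤ n).eq_or_lt with rfl | hn
  · rw [optUtility, isGreatest_benchmarkUtilities_instanceI_one.csSup_eq]
    norm_num
  · exact (isGreatest_benchmarkUtilities_instanceI hn).csSup_eq.ge

theorem senderUtility_instanceI_le_two_div_mul_optUtility [NeZero n] {φ : Mechanism n}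
    (hI : PersuasiveDisclosure φ (instanceI n)) (hII : PersuasiveDisclosure φ (instanceII n)) :
    senderUtility φ (instanceI n) ≤ 2 / n * optUtility (instanceI n) :=
  calc senderUtility φ (instanceI n)
      ≤ 1 / n := senderUtility_instanceI_le hI hII
    _ = 2 / n * (1 / 2) := by ring
    _ ≤ 2 / n * optUtility (instanceI n) := by gcongr; exact one_half_le_optUtility_instanceI

end OnlinePersuasion

theorem mainTheorem5 :
    (∀ n : ℕ, 1 ≤ n → ∃ θ : Instance n,
      0 < optSuccess θ ∧ 0 < optUtility θ ∧
      ∀ φ : Mechanism n, SecretaryPersuasive φ →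
        successProb φ θ ≤ 2 / (n : ℝ) * optSuccess θ ∧
        senderUtility φ θ ≤ 2 / (n : ℝ) * optUtility θ) ∧
    (∀ n : ℕ, 2 ≤ n →
      IsGreatest (benchmarkSuccesses (instanceI n)) (1 / 2) ∧
      IsGreatest (benchmarkUtilities (instanceI n)) (1 / 2) ∧
      successProb (hireFirst n) (instanceI n) = 1 / (n : ℝ) ∧
      senderUtility (hireFirst n) (instanceI n) = 1 / (n : ℝ) ∧
      ∀ φ : Mechanism n,
        PersuasiveDisclosure φ (instanceI n) → PersuasiveDisclosure φ (instanceII n) →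
          successProb φ (instanceI n) ≤ 2 / (n : ℝ) * optSuccess (instanceI n) ∧
          senderUtility φ (instanceI n) ≤ 2 / (n : ℝ) * optUtility (instanceI n) ∧
          successProb φ (instanceI n) ≤ successProb (hireFirst n) (instanceI n) ∧
          senderUtility φ (instanceI n) ≤ senderUtility (hireFirst n) (instanceI n)) := by
  refine ⟨fun n hn => ?_, fun n hn => ?_⟩
  · have : NeZero n := ⟨by omega⟩
    have hOPT : 0 < optUtility (instanceI n) :=
      one_half_pos.trans_le one_half_le_optUtility_instanceI
    refine ⟨instanceI n, by rwa [optSuccess_instanceI], hOPT, fun φ hφ => ?_⟩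
    have hbound := senderUtility_instanceI_le_two_div_mul_optUtility
      (hφ (instanceI n)) (hφ (instanceII n))
    rw [successProb_instanceI, optSuccess_instanceI]
    exact ⟨hbound, hbound⟩
  · have : NeZero n := ⟨by omega⟩
    have hOPT := isGreatest_benchmarkUtilities_instanceI hn
    simp only [benchmarkSuccesses_instanceI, successProb_instanceI, optSuccess_instanceI,
      senderUtility_hireFirst_instanceI]
    refine ⟨hOPT, hOPT, trivial, trivial, fun φ hI hII => ?_⟩
    have hbound := senderUtility_instanceI_le_two_div_mul_optUtility hI hII
    have hround := senderUtility_instanceI_le hI hII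
    exact ⟨hbound, hbound, hround, hround⟩
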